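/- All graphs are finite and simple. For a graph $G$ and a half-integer $r=s/2\ge 0$ ($s\in\mathbb{N}$), put $d=\lceil r\rceil$. A graph $G'$ is a shallow minor of $G$ at depth $r$ if there are pairwise disjoint sets $B_i\subseteq V(G)$ with centers $x_i\in B_i$, for $i\in V(G')$, such that every vertex of $B_i$ is at distance at most $d$ from $x_i$ in $G[B_i]$, and such that for every edge $ij$ of $G'$ there is an edge $uv$ of $G$ with $u\in B_i$, $v\in B_j$, where, if $r$ is not an integer, moreover $\mathrm{dist}_{G[B_i]}(x_i,u)<d$ or $\mathrm{dist}_{G[B_j]}(x_j,v)<d$. Let $\nabla_r(G)$ be the maximum of $|E(G')|/|V(G')|$ over the nonempty shallow minors $G'$ of $G$ at depth $r$ (and $0$ if there are none). A $t$-fraternity function on a finite set $\mathcal V$ is a function $\omega:\mathcal V\times\mathcal V\to\{1,2,3,\dots\}\cup\{\infty\}$ such that for all $x,y$ at least one of $\omega(x,y),\omega(y,x)$ is $\infty$, and for all $x\ne y$, with $m=\min(\omega(x,y),\omega(y,x))$ and $\mu=\min_{z\in\mathcal V\setminus\{x,y\}}(\omega(z,x)+\omega(z,y))$ (where $\min\emptyset=\infty$),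 one has $m=1$, or $m=\mu$, or both $m>t$ and $\mu>t$. A directed weighted graph $\vec G$ forms a $t$-fraternity function $\omega$ on its vertex set if its arcs are the pairs $(u,v)$ with $\omega(u,v)\le t$, the weight of $(u,v)$ being $\omega(u,v)$. A $t$-fraternal extension of a graph $F$ is a directed weighted graph on $V(F)$ that forms a $t$-fraternity function and whose arcs of weight $1$ form an orientation of $F$. It is an optimal acyclic $t$-fraternal extension of $F$ if for every $1\le i\le t$ the arcs of weight $i$ form a degeneracy orientation of the undirected graph of the edges of weight $i$, that is, an acyclic orientation whose maximum outdegree equals the degeneracy of that undirected graph (the least $\kappa$ such that every nonempty subgraph has a vertex of degree at most $\kappa$). Let $t\ge 1$ be an integer and let $C\ge 0$ be a real number. There is a constant $\Delta$, depending only on $t$ and $C$, such that for every graph $F$ with $\nabla_{(t-1)/2}(F)\le C$, every optimal acyclic $t$-fraternal extension of $F$ has maximum outdegree at most $\Delta$ (counting the arcs of all weights). -/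

import Mathlib

open scoped ENNReal NNReal

/-- `IsShallowMinor s G' G`: the graph `G'` is a shallow minor of `G` at depth `s / 2`, where `s` is
a natural number, so that the depth ranges over integers and half-integers. Put `d = ⌈s / 2⌉`, that
is `s / 2 = d` for `s` even and `s / 2 = d - 1 / 2` for `s` odd. The vertices `i` of `G'` are
represented by disjoint sets `B i` of vertices of `G`, each with a center `x i` from which every
vertex of `B i` is at distance at most `d` in the graph induced on `B i`; every edge `i j` of `G'` is
witnessed by an (external) edge `u v` of `G` with `u ∈ B i` and `v ∈ B j`; and at half-integer depth,
one of the ends of this external edge is at distance strictly less than `d` from its center. -/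
def IsShallowMinor {W V : Type*} (s : ℕ) (G' : SimpleGraph W) (G : SimpleGraph V) : Prop :=
  ∃ (B : W → Set V) (x : ∀ i, B i),
    (∀ i j, i ≠ j → Disjoint (B i) (B j)) ∧
    (∀ (i : W) (v : B i), (G.induce (B i)).edist (x i) v ≤ ((s + 1) / 2 : ℕ)) ∧
    ∀ i j, G'.Adj i j → ∃ (u : B i) (v : B j), G.Adj u v ∧
      (Odd s → (G.induce (B i)).edist (x i) u < ((s + 1) / 2 : ℕ) ∨
        (G.induce (B j)).edist (x j) v < ((s + 1) / 2 : ℕ))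

/-- The greatest reduced average density `∇_{s/2}(G)` of rank `s / 2`: the supremum of
`|E(G')| / |V(G')|` over the (finite, nonempty) shallow minors `G'` of `G` at depth `s / 2`. -/
noncomputable def grad {V : Type*} (s : ℕ) (G : SimpleGraph V) : ℝ≥0∞ :=
  ⨆ (p : ℕ) (G' : SimpleGraph (Fin (p + 1))) (_ : IsShallowMinor s G' G),
    (Nat.card G'.edgeSet : ℝ≥0∞) / ((p + 1 : ℕ) : ℝ≥0∞)

/-- `G` is `κ`-degenerate: every (nonempty) subgraph has minimum degree at most `κ`. -/
def IsDegenerate {V : Type*} (G : SimpleGraph V) (κ : ℕ∞) : Prop :=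
  ∀ H : G.Subgraph, H.verts.Nonempty → ∃ v ∈ H.verts, (H.neighborSet v).encard ≤ κ

/-- The degeneracy of `G`: the least `κ` such that `G` is `κ`-degenerate. -/
noncomputable def degeneracy {V : Type*} (G : SimpleGraph V) : ℕ∞ :=
  sInf {κ | IsDegenerate G κ}

/-- The maximum outdegree `Δ⁺` of a directed graph. -/
noncomputable def maxOutDegree {V : Type*} (D : Digraph V) : ℕ∞ :=
  ⨆ v, {w | D.Adj v w}.encard

/-- A directed graph without directed cycles (in particular without loops). -/
def IsAcyclicDigraph {V : Type*} (D : Digraph V) : Prop :=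
  ∀ v, ¬ Relation.TransGen D.Adj v v

/-- `D` is an orientation of `G`: each edge of `G` gets exactly one of its two directions, and `D`
has no other arcs. -/
def IsOrientation {V : Type*} (D : Digraph V) (G : SimpleGraph V) : Prop :=
  (∀ u v, G.Adj u v ↔ D.Adj u v ∨ D.Adj v u) ∧ ∀ u v, ¬ (D.Adj u v ∧ D.Adj v u)

/-- `D` is a degeneracy orientation of `G`: an acyclic orientation whose maximum outdegree is the
degeneracy of `G`. -/
def IsDegeneracyOrientation {V : Type*} (D : Digraph V) (G : SimpleGraph V) : Prop :=
  IsOrientation D G ∧ IsAcyclicDigraph D ∧ maxOutDegree D = degeneracy G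

/-- A directed weighted graph: a directed graph and a weight for each arc. The values of `weight` on
pairs that are not arcs carry no meaning. -/
structure WeightedDigraph (V : Type*) extends Digraph V where
  weight : V → V → ℕ

/-- The directed graph of the arcs of weight `i`. -/
def WeightedDigraph.layer {V : Type*} (M : WeightedDigraph V) (i : ℕ) : Digraph V where
  Adj u v := M.Adj u v ∧ M.weight u v = i

/-- `ω` is a `t`-fraternity function: its values are positive integers or `∞`, one of `ω x y` and
`ω y x` is `∞`, and each pair `x ≠ y` satisfies one of the three alternatives (a minimum over no
vertex `z` is `∞`). -/
structure IsFraternityFunction {V : Type*} (t : ℕ) (ω : V → V → ℕ∞) : Prop where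
  pos : ∀ x y, 1 ≤ ω x y
  eq_top : ∀ x y, ω x y = ⊤ ∨ ω y x = ⊤
  frat : ∀ x y, x ≠ y →
    min (ω x y) (ω y x) = 1 ∨
    min (ω x y) (ω y x) = (⨅ z ∈ ({x, y} : Set V)ᶜ, (ω z x + ω z y)) ∨
    ((t : ℕ∞) < min (ω x y) (ω y x) ∧ (t : ℕ∞) < ⨅ z ∈ ({x, y} : Set V)ᶜ, (ω z x + ω z y))

/-- `M` forms a `t`-fraternity function: for some `t`-fraternity function `ω`, the arcs of `M` are
the pairs with `ω u v ≤ t`, with weight `ω u v`. -/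
def FormsFraternityFunction {V : Type*} (t : ℕ) (M : WeightedDigraph V) : Prop :=
  ∃ ω : V → V → ℕ∞, IsFraternityFunction t ω ∧
    (∀ u v, M.Adj u v ↔ ω u v ≤ t) ∧ ∀ u v, M.Adj u v → (M.weight u v : ℕ∞) = ω u v

/-- `M` is a `t`-fraternal extension of the directed graph `D`. -/
def IsFraternalExtensionOfDigraph {V : Type*} (t : ℕ) (D : Digraph V) (M : WeightedDigraph V) :
    Prop :=
  FormsFraternityFunction t M ∧ D = M.layer 1

/-- `M` is a `t`-fraternal extension of the undirected graph `F`: it is one of some orientation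
of `F`. -/
def IsFraternalExtension {V : Type*} (t : ℕ) (F : SimpleGraph V) (M : WeightedDigraph V) : Prop :=
  ∃ D : Digraph V, IsOrientation D F ∧ IsFraternalExtensionOfDigraph t D M

/-- `M` is an optimal acyclic `t`-fraternal extension of `F`: for every `i ∈ [1, t]`, the arcs of
weight `i` form a degeneracy orientation of the undirected graph of the edges of weight `i`. -/
def IsOptimalAcyclicFraternalExtension {V : Type*} (t : ℕ) (F : SimpleGraph V)
    (M : WeightedDigraph V) : Prop :=
  IsFraternalExtension t F M ∧
    ∀ i, 1 ≤ i → i ≤ t →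
      IsDegeneracyOrientation (M.layer i) (M.layer i).toSimpleGraphInclusive

/-!
The outdegree is bounded weight by weight. In a fraternal extension of `F`, the ends of an arc of
weight `i > 1` have a common in-neighbor, and the two arcs from it have total weight `i`. By
induction, the arc is realized by a walk of length at most `i` in `F`, from each internal vertex of
which both ends are reached by at most `i` lighter arcs. As the lighter arcs have bounded outdegree,
a vertex is internal to boundedly many of these walks. Hence in any subgraph of the graph of edges
of weight `i`, a maximal family of internally disjoint walks avoiding the vertices of the subgraph
contains a fixed proportion of all the walks, up to an error linear in the number of vertices. Such
a family is a shallow topological minor of `F`; splitting each path between its ends turns it into a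
shallow minor at depth `(t - 1) / 2`. So the graph of edges of weight `i` has bounded density on
every subgraph, hence bounded degeneracy, which by optimality bounds the outdegree in weight `i`.
-/

section ShallowMinors

variable {V W : Type*} {s : ℕ} {G : SimpleGraph V} {H : SimpleGraph W}

theorem IsShallowMinor.card_edgeSet_le_grad_mul_card [Finite W] (h : IsShallowMinor s H G) :
    (Nat.card H.edgeSet : ℝ≥0∞) ≤ grad s G * Nat.card W := by
  rcases isEmpty_or_nonempty W with _ | _
  · simp
  obtain ⟨p, hp⟩ : ∃ p, Nat.card W = p + 1 := Nat.exists_eq_succ_of_ne_zero Nat.card_pos.ne'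
  let φ : Fin (p + 1) ≃ W := (Finite.equivFinOfCardEq hp).symm
  have hminor : IsShallowMinor s (H.comap φ) G := by
    obtain ⟨B, x, hdisj, hdist, hadj⟩ := h
    exact ⟨fun i => B (φ i), fun i => x (φ i), fun i j hij => hdisj _ _ (φ.injective.ne hij),
      fun i v => hdist _ v, fun i j hij => hadj _ _ hij⟩
  have hcard : Nat.card (H.comap φ).edgeSet = Nat.card H.edgeSet :=
    Nat.card_congr (SimpleGraph.Iso.comap φ H).mapEdgeSet
  have hle : (Nat.card H.edgeSet : ℝ≥0∞) / Nat.card W ≤ grad s G := by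
    rw [hp, ← hcard]
    exact le_iSup_of_le p (le_iSup_of_le (H.comap φ) (le_iSup_of_le hminor le_rfl))
  exact (ENNReal.div_le_iff (by simp [hp]) (by simp)).1 hle

end ShallowMinors

section Walks

variable {V : Type*} {G : SimpleGraph V} {u v w : V}

theorem edist_induce_le_length (p : G.Walk u v) {B : Set V} (hB : ∀ w ∈ p.support, w ∈ B) :
    (G.induce B).edist ⟨u, hB u p.start_mem_support⟩ ⟨v, hB v p.end_mem_support⟩ ≤ p.length := by
  have hlength : (p.induce B hB).length = p.length := by
    have hsupport := congrArg List.length (p.support_induce hB)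
    simpa only [List.length_attachWith, SimpleGraph.Walk.length_support, Nat.add_right_cancel_iff]
      using hsupport
  exact hlength ▸ (p.induce B hB).edist_le

open Classical in
/-- The vertices of a walk other than its two ends. An end that the walk revisits is not counted as
internal, so that passing from a walk to a path inside it creates no new internal vertices. -/
noncomputable def internalVertices (p : G.Walk u v) : Finset V :=
  p.support.toFinset \ {u, v}

theorem mem_internalVertices {p : G.Walk u v} :
    w ∈ internalVertices p ↔ w ∈ p.support ∧ w ≠ u ∧ w ≠ v := by
  simp [internalVertices]

theorem internalVertices_reverse (p : G.Walk u v) :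
    internalVertices p.reverse = internalVertices p := by
  ext w
  simp only [mem_internalVertices, SimpleGraph.Walk.support_reverse, List.mem_reverse,
    and_comm (a := w ≠ v)]

theorem internalVertices_bypass_subset [DecidableEq V] (p : G.Walk u v) :
    internalVertices p.bypass ⊆ internalVertices p := fun _ hw =>
  mem_internalVertices.2
    ((mem_internalVertices.1 hw).imp_left (p.support_bypass_subset_support ·))

theorem card_internalVertices_le (p : G.Walk u v) :
    (internalVertices p).card ≤ p.length + 1 := by
  classical
  calc (internalVertices p).card ≤ p.support.toFinset.card :=
        Finset.card_le_card fun _ hw => List.mem_toFinset.2 (mem_internalVertices.1 hw).1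
    _ ≤ p.length + 1 := p.length_support ▸ p.support.toFinset_card_le

theorem getVert_mem_internalVertices {p : G.Walk u v} (hp : p.IsPath) {j : ℕ} (hj : 0 < j)
    (hjl : j < p.length) : p.getVert j ∈ internalVertices p :=
  mem_internalVertices.2 ⟨p.getVert_mem_support j,
    fun h => hj.ne' ((hp.getVert_eq_start_iff hjl.le).1 h),
    fun h => hjl.ne ((hp.getVert_eq_end_iff hjl.le).1 h)⟩

theorem adj_out_fst_out_snd (e : G.edgeSet) : G.Adj e.1.out.1 e.1.out.2 := by
  rw [← SimpleGraph.mem_edgeSet, show s(e.1.out.1, e.1.out.2) = e.1 from Quot.out_eq _]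
  exact e.2

end Walks

/-- A model of `H` as a shallow topological minor of `G` at depth `s / 2`, that is, of a subdivision
of `H` with at most `s` new vertices on each edge as a subgraph of `G`. A path and its reverse
represent the same edge `e` of `H`, so a single path is given, in the direction that `Quot.out`
chooses for `e`. -/
structure TopologicalModel {V W : Type*} (s : ℕ) (H : SimpleGraph W) (G : SimpleGraph V) where
  vertex : W ↪ V
  path (e : H.edgeSet) : G.Walk (vertex e.1.out.1) (vertex e.1.out.2)
  isPath (e : H.edgeSet) : (path e).IsPath
  length_path_le (e : H.edgeSet) : (path e).length ≤ s + 1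
  vertex_notMem (e : H.edgeSet) (a : W) : vertex a ∉ internalVertices (path e)
  disjoint_internalVertices {e e' : H.edgeSet} :
    e ≠ e' → Disjoint (internalVertices (path e)) (internalVertices (path e'))

namespace TopologicalModel

variable {V W : Type*} {s : ℕ} {G : SimpleGraph V} {H : SimpleGraph W}
  (T : TopologicalModel s H G)

/-- The branch set of `a` in the shallow minor obtained by contracting a topological model: the
internal vertices of each path are shared between its ends, those at distance at most `(s + 1) / 2`
along the path going to the first end. -/
def branchSet (a : W) : Set V :=
  {v | v = T.vertex a ∨ ∃ (e : H.edgeSet) (j : ℕ), 0 < j ∧ j < (T.path e).length ∧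
    v = (T.path e).getVert j ∧
      (e.1.out.1 = a ∧ j ≤ (s + 1) / 2 ∨ e.1.out.2 = a ∧ (s + 1) / 2 < j)}

/-- The representative of `a`, as the center of its branch set. -/
def center (a : W) : T.branchSet a :=
  ⟨T.vertex a, Or.inl rfl⟩

variable {T}

theorem eq_of_getVert_eq {e e' : H.edgeSet} {j j' : ℕ} (hj : 0 < j) (hjl : j < (T.path e).length)
    (hj' : 0 < j') (hjl' : j' < (T.path e').length)
    (h : (T.path e).getVert j = (T.path e').getVert j') : e = e' ∧ j = j' := by
  have hmem := getVert_mem_internalVertices (T.isPath e) hj hjl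
  have hmem' := getVert_mem_internalVertices (T.isPath e') hj' hjl'
  obtain rfl : e = e' := by
    by_contra hne
    exact Finset.disjoint_left.1 (T.disjoint_internalVertices hne) hmem (h ▸ hmem')
  exact ⟨rfl, (T.isPath e).getVert_injOn hjl.le hjl'.le h⟩

theorem disjoint_branchSet {a b : W} (hab : a ≠ b) :
    Disjoint (T.branchSet a) (T.branchSet b) := by
  rw [Set.disjoint_left]
  rintro v (rfl | ⟨e, j, hj, hjl, rfl, hside⟩) (hv | ⟨e', j', hj', hjl', hv, hside'⟩)
  · exact hab (T.vertex.injective hv)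
  · exact T.vertex_notMem e' a (hv ▸ getVert_mem_internalVertices (T.isPath e') hj' hjl')
  · exact T.vertex_notMem e b (hv ▸ getVert_mem_internalVertices (T.isPath e) hj hjl)
  · obtain ⟨rfl, rfl⟩ := eq_of_getVert_eq hj hjl hj' hjl' hv
    rcases hside with ⟨rfl, hle⟩ | ⟨rfl, hlt⟩ <;> rcases hside' with ⟨hb, hle'⟩ | ⟨hb, hlt'⟩
    exacts [hab hb, by omega, by omega, hab hb]

theorem exists_edist_center_fst_le {e : H.edgeSet} {j : ℕ} (hjl : j < (T.path e).length)
    (hjs : j ≤ (s + 1) / 2) :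
    ∃ hv : (T.path e).getVert j ∈ T.branchSet e.1.out.1,
      (G.induce (T.branchSet e.1.out.1)).edist (T.center e.1.out.1) ⟨_, hv⟩ ≤ j := by
  have hsupport : ∀ w ∈ ((T.path e).take j).support, w ∈ T.branchSet e.1.out.1 := by
    intro w hw
    obtain ⟨k, rfl, -⟩ := SimpleGraph.Walk.mem_support_iff_exists_getVert.1 hw
    rw [SimpleGraph.Walk.take_getVert]
    rcases Nat.eq_zero_or_pos (j ⊓ k) with h0 | hpos
    · exact Or.inl (by rw [h0, SimpleGraph.Walk.getVert_zero])
    · exact Or.inr ⟨e, j ⊓ k, hpos, by omega, rfl, Or.inl ⟨rfl, by omega⟩⟩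
  refine ⟨hsupport _ (SimpleGraph.Walk.end_mem_support _),
    (edist_induce_le_length _ hsupport).trans ?_⟩
  simp

theorem exists_edist_center_snd_le {e : H.edgeSet} {j : ℕ} (hj : 0 < j)
    (hjl : j ≤ (T.path e).length) (hjs : (s + 1) / 2 < j ∨ j = (T.path e).length) :
    ∃ hv : (T.path e).getVert j ∈ T.branchSet e.1.out.2,
      (G.induce (T.branchSet e.1.out.2)).edist (T.center e.1.out.2) ⟨_, hv⟩ ≤
        ((T.path e).length - j : ℕ) := by
  have hsupport : ∀ w ∈ ((T.path e).drop j).reverse.support, w ∈ T.branchSet e.1.out.2 := by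
    intro w hw
    rw [SimpleGraph.Walk.support_reverse, List.mem_reverse] at hw
    obtain ⟨k, rfl, hk⟩ := SimpleGraph.Walk.mem_support_iff_exists_getVert.1 hw
    rw [SimpleGraph.Walk.drop_length] at hk
    rw [SimpleGraph.Walk.drop_getVert]
    rcases eq_or_lt_of_le (by omega : j + k ≤ (T.path e).length) with hend | hlt
    · exact Or.inl (by rw [hend, SimpleGraph.Walk.getVert_length])
    · exact Or.inr ⟨e, j + k, by omega, hlt, rfl, Or.inr ⟨rfl, by omega⟩⟩
  refine ⟨hsupport _ (SimpleGraph.Walk.end_mem_support _),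
    (edist_induce_le_length _ hsupport).trans ?_⟩
  simp

theorem edist_center_le (a : W) (v : T.branchSet a) :
    (G.induce (T.branchSet a)).edist (T.center a) v ≤ ((s + 1) / 2 : ℕ) := by
  obtain ⟨v, hv⟩ := v
  rcases id hv with rfl | ⟨e, j, hj, hjl, rfl, ⟨rfl, hjs⟩ | ⟨rfl, hjs⟩⟩
  · exact SimpleGraph.edist_self.trans_le zero_le
  · obtain ⟨_, hdist⟩ := exists_edist_center_fst_le hjl hjs
    exact hdist.trans (by exact_mod_cast hjs)
  · obtain ⟨_, hdist⟩ := exists_edist_center_snd_le hj hjl.le (Or.inl hjs)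
    have := T.length_path_le e
    exact hdist.trans (by exact_mod_cast (by omega : (T.path e).length - j ≤ (s + 1) / 2))

theorem exists_adj_branchSet (e : H.edgeSet) :
    ∃ (u : T.branchSet e.1.out.1) (v : T.branchSet e.1.out.2), G.Adj u v ∧
      (Odd s → (G.induce (T.branchSet e.1.out.2)).edist (T.center e.1.out.2) v <
        ((s + 1) / 2 : ℕ)) := by
  have hpos : 0 < (T.path e).length := by
    refine Nat.pos_of_ne_zero fun h0 => ?_
    have hloop : e.1.out.1 = e.1.out.2 :=
      T.vertex.injective (SimpleGraph.Walk.eq_of_length_eq_zero h0)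
    exact (adj_out_fst_out_snd e).ne hloop
  have hle := T.length_path_le e
  -- Cut the path as late as its first end permits: what is left for the second end has fewer than
  -- `(s + 1) / 2` edges when `s` is odd.
  obtain ⟨j, hjl, hjs, hcut⟩ : ∃ j, j < (T.path e).length ∧ j ≤ (s + 1) / 2 ∧
      ((s + 1) / 2 < j + 1 ∨ j + 1 = (T.path e).length) :=
    ⟨min ((s + 1) / 2) ((T.path e).length - 1), by omega, by omega, by omega⟩
  obtain ⟨hu, -⟩ := exists_edist_center_fst_le hjl hjs
  obtain ⟨hv, hdist⟩ := exists_edist_center_snd_le j.succ_pos hjl hcut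
  refine ⟨⟨_, hu⟩, ⟨_, hv⟩, (T.path e).adj_getVert_succ hjl, fun ⟨r, hr⟩ => hdist.trans_lt ?_⟩
  exact_mod_cast (by omega : (T.path e).length - (j + 1) < (s + 1) / 2)

theorem isShallowMinor (T : TopologicalModel s H G) : IsShallowMinor s H G := by
  refine ⟨T.branchSet, T.center, fun _ _ => disjoint_branchSet, edist_center_le, fun a b hab => ?_⟩
  let e : H.edgeSet := ⟨s(a, b), hab⟩
  have hedge := T.exists_adj_branchSet e
  have hout : s(e.1.out.1, e.1.out.2) = s(a, b) := Quot.out_eq _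
  rcases Sym2.eq_iff.1 hout with ⟨ha, hb⟩ | ⟨hb, ha⟩
  · rw [ha, hb] at hedge
    obtain ⟨u, v, huv, hodd⟩ := hedge
    exact ⟨u, v, huv, fun hs => Or.inr (hodd hs)⟩
  · rw [ha, hb] at hedge
    obtain ⟨v, u, hvu, hodd⟩ := hedge
    exact ⟨u, v, hvu.symm, fun hs => Or.inl (hodd hs)⟩

end TopologicalModel

section Congestion

theorem exists_pairwiseDisjoint_subfamily {ι V : Type*} [Fintype ι] [DecidableEq V]
    (I : ι → Finset V) (A : Finset V) {m k : ℕ} (hm : ∀ e, (I e).card ≤ m)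
    (hk : ∀ w, (Finset.univ.filter fun e => w ∈ I e).card ≤ k) :
    ∃ S : Finset ι, (S : Set ι).PairwiseDisjoint I ∧ (∀ e ∈ S, Disjoint (I e) A) ∧
      Fintype.card ι ≤ S.card + (A.card + S.card * m) * k := by
  classical
  obtain ⟨S, ⟨hdisj, havoid⟩, hmax⟩ := Set.Finite.exists_maximal
    (s := {S : Finset ι | (S : Set ι).PairwiseDisjoint I ∧ ∀ e ∈ S, Disjoint (I e) A})
    (Set.toFinite _) ⟨∅, by simp⟩
  refine ⟨S, hdisj, havoid, ?_⟩
  have hcover : Finset.univ ⊆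
      S ∪ (A ∪ S.biUnion I).biUnion fun w => Finset.univ.filter fun e => w ∈ I e := by
    intro e _
    by_contra! he
    simp only [Finset.mem_union, Finset.mem_biUnion, Finset.mem_filter, Finset.mem_univ, true_and,
      not_or, not_exists, not_and] at he
    obtain ⟨heS, hfree⟩ := he
    refine heS (hmax (y := insert e S) ⟨?_, ?_⟩ (Finset.subset_insert e S)
      (Finset.mem_insert_self e S))
    · rw [Finset.coe_insert]
      refine hdisj.insert fun e' he' _ => Finset.disjoint_right.2 fun w hw => ?_
      exact hfree w (Or.inr ⟨e', he', hw⟩)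
    · exact Finset.forall_mem_insert _ _ _ |>.2
        ⟨Finset.disjoint_right.2 fun w hw => hfree w (Or.inl hw), havoid⟩
  calc Fintype.card ι
      ≤ S.card + ((A ∪ S.biUnion I).biUnion fun w => Finset.univ.filter fun e => w ∈ I e).card :=
        (Finset.card_le_card hcover).trans (Finset.card_union_le _ _)
    _ ≤ S.card + (A ∪ S.biUnion I).card * k := by
        gcongr
        exact Finset.card_biUnion_le_card_mul _ _ _ fun w _ => hk w
    _ ≤ S.card + (A.card + S.card * m) * k := by
        gcongr
        exact (Finset.card_union_le _ _).trans
          (Nat.add_le_add_left (Finset.card_biUnion_le_card_mul _ _ _ fun e _ => hm e) _)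

/-- The number of edges per vertex that a graph can have when its edges are represented in a graph
`G` with `grad s G ≤ c` by walks of length at most `s + 1`, each vertex being internal to at most
`k` of them. -/
def congestionBound (s c k : ℕ) : ℕ :=
  k + c * (1 + (s + 2) * k)

variable {V W : Type*} [Finite W] {s c : ℕ} {G : SimpleGraph V} {H : SimpleGraph W}

theorem card_le_of_internally_disjoint (hgrad : grad s G ≤ c) (φ : W ↪ V)
    (P : ∀ e : H.edgeSet, G.Walk (φ e.1.out.1) (φ e.1.out.2)) {S : Finset H.edgeSet}
    (hlength : ∀ e ∈ S, (P e).length ≤ s + 1)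
    (hdisj : (S : Set H.edgeSet).PairwiseDisjoint fun e => internalVertices (P e))
    (havoid : ∀ e ∈ S, ∀ a, φ a ∉ internalVertices (P e)) :
    S.card ≤ c * Nat.card W := by
  classical
  let H' : SimpleGraph W := SimpleGraph.fromEdgeSet (Subtype.val '' (S : Set H.edgeSet))
  have hedges : H'.edgeSet = Subtype.val '' (S : Set H.edgeSet) := by
    rw [SimpleGraph.edgeSet_fromEdgeSet, sdiff_eq_left, Set.disjoint_left]
    rintro _ ⟨e, -, rfl⟩
    exact H.not_isDiag_of_mem_edgeSet e.2
  have hlift : ∀ e : H'.edgeSet, ∃ he : e.1 ∈ H.edgeSet, ⟨e.1, he⟩ ∈ S := by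
    rintro ⟨_, he⟩
    obtain ⟨e, heS, rfl⟩ := hedges.subset he
    exact ⟨e.2, heS⟩
  choose hH hS using hlift
  let T : TopologicalModel s H' G :=
    { vertex := φ
      path := fun e => (P ⟨e.1, hH e⟩).bypass
      isPath := fun e => (P _).bypass_isPath
      length_path_le := fun e => (P _).length_bypass_le_length.trans (hlength _ (hS e))
      vertex_notMem := fun e a ha => havoid _ (hS e) a (internalVertices_bypass_subset _ ha)
      disjoint_internalVertices := fun {e e'} hne =>
        (hdisj (hS e) (hS e') fun h => hne (Subtype.ext (Subtype.mk.inj h))).mono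
          (internalVertices_bypass_subset _) (internalVertices_bypass_subset _) }
  have hcard : Nat.card H'.edgeSet = S.card := by
    rw [hedges, Nat.card_image_of_injective Subtype.val_injective, Nat.card_coe_set_eq,
      Set.ncard_coe_finset]
  have hle := T.isShallowMinor.card_edgeSet_le_grad_mul_card.trans
    (mul_le_mul_left hgrad (Nat.card W : ℝ≥0∞))
  rw [hcard] at hle
  exact_mod_cast hle

theorem card_edgeSet_le_of_congestion {k : ℕ} (hgrad : grad s G ≤ c) (φ : W ↪ V)
    (P : ∀ e : H.edgeSet, G.Walk (φ e.1.out.1) (φ e.1.out.2)) (hlength : ∀ e, (P e).length ≤ s + 1)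
    (hk : ∀ w, {e | w ∈ internalVertices (P e)}.ncard ≤ k) :
    Nat.card H.edgeSet ≤ congestionBound s c k * Nat.card W := by
  classical
  have := Fintype.ofFinite W
  obtain ⟨S, hdisj, havoid, hcard⟩ := exists_pairwiseDisjoint_subfamily
    (fun e => internalVertices (P e)) (Finset.univ.map φ) (m := s + 2) (k := k)
    (fun e => (card_internalVertices_le _).trans (Nat.succ_le_succ (hlength e)))
    (fun w => by simpa only [Set.ncard_eq_toFinset_card', Set.toFinset_ofPred] using hk w)
  have hS : S.card ≤ c * Nat.card W :=
    card_le_of_internally_disjoint hgrad φ P (fun e _ => hlength e) hdisj fun e he a ha =>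
      Finset.disjoint_left.1 (havoid e he) ha (Finset.mem_map_of_mem φ (Finset.mem_univ a))
  rw [Finset.card_map, Finset.card_univ, ← Nat.card_eq_fintype_card,
    ← Nat.card_eq_fintype_card] at hcard
  calc Nat.card H.edgeSet ≤ S.card + (Nat.card W + S.card * (s + 2)) * k := hcard
    _ ≤ c * Nat.card W + (Nat.card W + c * Nat.card W * (s + 2)) * k := by gcongr
    _ = congestionBound s c k * Nat.card W := by rw [congestionBound]; ring

theorem card_edgeSet_le_of_localized {N : ℕ} (hgrad : grad s G ≤ c) (φ : W ↪ V)
    {R : V → Finset V} (hR : ∀ v, (R v).card ≤ N)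
    (hwalk : ∀ a b, H.Adj a b → ∃ p : G.Walk (φ a) (φ b), p.length ≤ s + 1 ∧
      ∀ w ∈ internalVertices p, φ a ∈ R w ∧ φ b ∈ R w) :
    Nat.card H.edgeSet ≤ congestionBound s c (N ^ 2) * Nat.card W := by
  choose P hlength hloc using fun e : H.edgeSet => hwalk _ _ (adj_out_fst_out_snd e)
  refine card_edgeSet_le_of_congestion hgrad φ P hlength fun w => ?_
  calc {e | w ∈ internalVertices (P e)}.ncard ≤ (R w ×ˢ R w : Finset (V × V)).card := by
        rw [← Set.ncard_coe_finset]
        refine Set.ncard_le_ncard_of_injOn (fun e => (φ e.1.out.1, φ e.1.out.2))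
          (fun e he => Finset.mem_product.2 (hloc e w he)) (fun e _ e' _ h => ?_)
        have hout : e.1.out = e'.1.out :=
          Prod.ext (φ.injective (congrArg Prod.fst h)) (φ.injective (congrArg Prod.snd h))
        exact Subtype.ext (((Quot.out_eq _).symm.trans (congrArg _ hout)).trans (Quot.out_eq _))
    _ ≤ N ^ 2 := by
        rw [Finset.card_product, sq]
        exact Nat.mul_le_mul (hR w) (hR w)

end Congestion

theorem encard_setOf_adj_le_maxOutDegree {V : Type*} (D : Digraph V) (v : V) :
    {w | D.Adj v w}.encard ≤ maxOutDegree D :=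
  le_iSup (fun v => {w | D.Adj v w}.encard) v

theorem degeneracy_le_two_mul {V : Type*} [Finite V] {G : SimpleGraph V} {K : ℕ}
    (hK : ∀ H : G.Subgraph, Nat.card H.coe.edgeSet ≤ K * Nat.card H.verts) :
    degeneracy G ≤ (2 * K : ℕ) := by
  classical
  have := Fintype.ofFinite V
  refine sInf_le fun H hH => ?_
  have := hH.to_subtype
  have hhandshake := H.coe.sum_degrees_eq_twice_card_edges
  have hedges : H.coe.edgeFinset.card ≤ K * Fintype.card H.verts := by
    rw [SimpleGraph.edgeFinset_card, ← Nat.card_eq_fintype_card, ← Nat.card_eq_fintype_card]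
    exact hK H
  obtain ⟨v, -, hv⟩ := Finset.exists_le_of_sum_le (g := fun _ => 2 * K) Finset.univ_nonempty <| by
    rw [hhandshake, Finset.sum_const, Finset.card_univ, smul_eq_mul]
    linarith
  refine ⟨v, v.2, ?_⟩
  rw [SimpleGraph.Subgraph.coe_degree, ← SimpleGraph.Subgraph.finset_card_neighborSet_eq_degree]
    at hv
  rw [← Set.coe_toFinset (H.neighborSet v), Set.encard_coe_eq_coe_finsetCard]
  exact_mod_cast hv

section OutBall

variable {V : Type*} [DecidableEq V] {out : V → Finset V} {k l : ℕ} {u v w : V}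

/-- The vertices that can be reached from a vertex in at most `k` steps, a step from `u` leading to
a member of `out u`. -/
def outBall (out : V → Finset V) : ℕ → V → Finset V
  | 0, v => {v}
  | k + 1, v => (outBall out k v).biUnion fun u => insert u (out u)

theorem card_outBall_le {Δ : ℕ} (h : ∀ v, (out v).card ≤ Δ) (k : ℕ) (v : V) :
    (outBall out k v).card ≤ (Δ + 1) ^ k := by
  induction k with
  | zero => simp [outBall]
  | succ k ih =>
    rw [outBall, pow_succ]
    exact (Finset.card_biUnion_le_card_mul _ _ _ fun u _ =>
      (Finset.card_insert_le _ _).trans (Nat.succ_le_succ (h u))).trans (Nat.mul_le_mul_right _ ih)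

theorem outBall_mono (v : V) : Monotone fun k => outBall out k v :=
  monotone_nat_of_le_succ fun _ u hu =>
    Finset.mem_biUnion.2 ⟨u, hu, Finset.mem_insert_self _ _⟩

theorem mem_outBall_of_mem_out (hu : u ∈ outBall out k v) (hw : w ∈ out u) (hkl : k < l) :
    w ∈ outBall out l v :=
  outBall_mono v hkl (Finset.mem_biUnion.2 ⟨u, hu, Finset.mem_insert_of_mem hw⟩)

theorem self_mem_outBall (k : ℕ) (v : V) : v ∈ outBall out k v :=
  outBall_mono v (Nat.zero_le k) (Finset.mem_singleton_self v)

end OutBall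

namespace IsFraternityFunction

variable {V : Type*} {t : ℕ} {ω : V → V → ℕ∞} {x y : V} {a : ℕ}

theorem ne_of_ne_top (h : IsFraternityFunction t ω) (hxy : ω x y ≠ ⊤) : x ≠ y := by
  rintro rfl
  exact hxy ((h.eq_top x x).elim id id)

theorem exists_common_inNeighbor (h : IsFraternityFunction t ω) (hxy : ω x y = a) (ha : 2 ≤ a)
    (hat : a ≤ t) : ∃ (z : V) (b c : ℕ), ω z x = b ∧ ω z y = c ∧ 1 ≤ b ∧ 1 ≤ c ∧ b + c ≤ a := by
  have hyx : ω y x = ⊤ := (h.eq_top x y).resolve_left (by simp [hxy])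
  have hmin : min (ω x y) (ω y x) = a := by rw [hyx, hxy, min_eq_left le_top]
  have hinf : (⨅ z ∈ ({x, y} : Set V)ᶜ, (ω z x + ω z y)) < a + 1 := by
    rcases hmin ▸ h.frat x y (h.ne_of_ne_top (by simp [hxy])) with hone | heq | ⟨hlt, -⟩
    · norm_cast at hone
      omega
    · exact heq ▸ ENat.lt_natCast_add_one_iff.2 le_rfl
    · exact absurd hlt (not_lt.2 (by exact_mod_cast hat))
  simp only [iInf_lt_iff] at hinf
  obtain ⟨z, -, hz⟩ := hinf
  have hx := h.pos z x
  have hy := h.pos z y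
  lift ω z x to ℕ using (le_self_add.trans_lt hz).ne_top with b hb
  lift ω z y to ℕ using (le_add_self.trans_lt hz).ne_top with c hc
  norm_cast at hx hy hz
  exact ⟨z, b, c, hb.symm, hc.symm, hx, hy, Nat.le_of_lt_succ hz⟩

theorem exists_walk [DecidableEq V] {F : SimpleGraph V} {out : V → Finset V}
    (h : IsFraternityFunction t ω) (hF : ∀ x y, ω x y = 1 → F.Adj x y) (hat : a ≤ t)
    (hout : ∀ u v, ω u v < a → v ∈ out u) (hxy : ω x y = a) :
    ∃ p : F.Walk x y, p.length ≤ a ∧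
      ∀ w ∈ internalVertices p, x ∈ outBall out a w ∧ y ∈ outBall out a w := by
  induction a using Nat.strong_induction_on generalizing x y with
  | _ a ih =>
  have ha : 1 ≤ a := by exact_mod_cast hxy ▸ h.pos x y
  rcases ha.eq_or_lt with rfl | ha2
  · refine ⟨(hF x y (by simpa using hxy)).toWalk, by simp, fun w hw => ?_⟩
    obtain ⟨hw, hwx, hwy⟩ := mem_internalVertices.1 hw
    have hends : w = x ∨ w = y := by simpa using hw
    exact absurd hends (not_or.2 ⟨hwx, hwy⟩)
  obtain ⟨z, b, c, hb, hc, hb1, hc1, hbc⟩ := h.exists_common_inNeighbor hxy ha2 hat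
  have hlt {n : ℕ} (hn : n < a) {u v : V} (huv : ω u v ≤ n) : ω u v < a :=
    huv.trans_lt (by exact_mod_cast hn)
  obtain ⟨p, hp, hpz⟩ := ih b (by omega) (by omega)
    (fun u v huv => hout u v (hlt (by omega) huv.le)) hb
  obtain ⟨q, hq, hqz⟩ := ih c (by omega) (by omega)
    (fun u v huv => hout u v (hlt (by omega) huv.le)) hc
  have hx : x ∈ out z := hout z x (hlt (by omega) hb.le)
  have hy : y ∈ out z := hout z y (hlt (by omega) hc.le)
  have hlength : (p.reverse.append q).length ≤ a := by
    rw [SimpleGraph.Walk.length_append, SimpleGraph.Walk.length_reverse]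
    omega
  refine ⟨p.reverse.append q, hlength, fun w hw => ?_⟩
  obtain ⟨hw, hwx, hwy⟩ := mem_internalVertices.1 hw
  suffices hz : ∃ k < a, z ∈ outBall out k w by
    obtain ⟨k, hk, hz⟩ := hz
    exact ⟨mem_outBall_of_mem_out hz hx hk, mem_outBall_of_mem_out hz hy hk⟩
  rcases eq_or_ne w z with rfl | hwz
  · exact ⟨0, ha, self_mem_outBall 0 w⟩
  rw [SimpleGraph.Walk.mem_support_append_iff, SimpleGraph.Walk.support_reverse,
    List.mem_reverse] at hw
  rcases hw with hw | hw
  · exact ⟨b, by omega, (hpz w (mem_internalVertices.2 ⟨hw, hwz, hwx⟩)).1⟩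
  · exact ⟨c, by omega, (hqz w (mem_internalVertices.2 ⟨hw, hwz, hwy⟩)).1⟩

end IsFraternityFunction

/-- The directed graph of the arcs of weight `i` of the complete directed graph weighted by `ω`. -/
def weightDigraph {V : Type*} (ω : V → V → ℕ∞) (i : ℕ) : Digraph V where
  Adj u v := ω u v = i

theorem layer_eq_weightDigraph {V : Type*} {t i : ℕ} {ω : V → V → ℕ∞} {M : WeightedDigraph V}
    (hadj : ∀ u v, M.Adj u v ↔ ω u v ≤ t) (hweight : ∀ u v, M.Adj u v → (M.weight u v : ℕ∞) = ω u v)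
    (hit : i ≤ t) : M.layer i = weightDigraph ω i := by
  ext u v
  constructor
  · rintro ⟨huv, rfl⟩
    exact (hweight u v huv).symm
  · intro (huv : ω u v = i)
    have hM : M.Adj u v := (hadj u v).2 (huv.trans_le (by exact_mod_cast hit))
    exact ⟨hM, by exact_mod_cast (hweight u v hM).trans huv⟩

section OutDegree

variable {V : Type*} [Finite V] {s t c i : ℕ} {F : SimpleGraph V} {ω : V → V → ℕ∞}

theorem degeneracy_weightDigraph_le {Δ : ℕ} (hgrad : grad s F ≤ c)
    (hω : IsFraternityFunction t ω) (hF : ∀ x y, ω x y = 1 → F.Adj x y) (hit : i ≤ t)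
    (his : i ≤ s + 1) (hΔ : ∀ v, {w | ω v w < i}.encard ≤ Δ) :
    degeneracy (weightDigraph ω i).toSimpleGraphInclusive ≤
      (2 * congestionBound s c (((Δ + 1) ^ i) ^ 2) : ℕ) := by
  classical
  have := Fintype.ofFinite V
  let out : V → Finset V := fun u => {w | ω u w < i}.toFinset
  have hcard : ∀ u, (out u).card ≤ Δ := fun u => by
    have := hΔ u
    rw [← Set.coe_toFinset {w | ω u w < i}, Set.encard_coe_eq_coe_finsetCard] at this
    exact_mod_cast this
  have hwalk {x y : V} (hxy : ω x y = i) : ∃ p : F.Walk x y, p.length ≤ s + 1 ∧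
      ∀ w ∈ internalVertices p, x ∈ outBall out i w ∧ y ∈ outBall out i w := by
    obtain ⟨p, hp, hloc⟩ := hω.exists_walk (out := out) hF hit
      (fun u v huv => Set.mem_toFinset.2 huv) hxy
    exact ⟨p, hp.trans his, hloc⟩
  refine degeneracy_le_two_mul fun H => card_edgeSet_le_of_localized hgrad
    (Function.Embedding.subtype _) (card_outBall_le hcard i) fun a b hab => ?_
  rcases (SimpleGraph.fromRel_adj _ _ _).1 (H.adj_sub hab) with ⟨-, hab | hba⟩
  · exact hwalk hab
  · obtain ⟨p, hp, hloc⟩ := hwalk hba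
    refine ⟨p.reverse, p.length_reverse.trans_le hp, fun w hw => ?_⟩
    exact (hloc w ((internalVertices_reverse p).subset hw)).symm

/-- The bound on the number of arcs of weight at most `i` leaving a vertex of a fraternal extension
of `F`, when `grad s F ≤ c`. -/
def outDegreeBound (s c : ℕ) : ℕ → ℕ
  | 0 => 0
  | i + 1 => outDegreeBound s c i +
      2 * congestionBound s c (((outDegreeBound s c i + 1) ^ (i + 1)) ^ 2)

theorem encard_setOf_weight_le_outDegreeBound (hgrad : grad s F ≤ c) (hts : t ≤ s + 1)
    (hω : IsFraternityFunction t ω) (hF : ∀ x y, ω x y = 1 → F.Adj x y)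
    (hdeg : ∀ i, 1 ≤ i → i ≤ t →
      maxOutDegree (weightDigraph ω i) ≤ degeneracy (weightDigraph ω i).toSimpleGraphInclusive)
    (hit : i ≤ t) (v : V) : {w | ω v w ≤ i}.encard ≤ outDegreeBound s c i := by
  induction i generalizing v with
  | zero =>
    have hempty : {w | ω v w ≤ (0 : ℕ)} = ∅ :=
      Set.eq_empty_of_forall_notMem fun w hw =>
        absurd ((hω.pos v w).trans hw) (by simp)
    rw [hempty, Set.encard_empty]
    exact zero_le
  | succ i ih =>
    have hlt (u w : V) : ω u w < (i + 1 : ℕ) ↔ ω u w ≤ i := by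
      rw [Nat.cast_add_one, ENat.lt_natCast_add_one_iff]
    have hsplit : {w | ω v w ≤ (i + 1 : ℕ)} =
        {w | ω v w ≤ i} ∪ {w | (weightDigraph ω (i + 1)).Adj v w} := by
      ext w
      exact le_iff_lt_or_eq.trans (or_congr_left (hlt v w))
    have hlighter (u : V) : {w | ω u w < (i + 1 : ℕ)}.encard ≤ outDegreeBound s c i := by
      simpa only [hlt] using ih (by omega) u
    calc {w | ω v w ≤ (i + 1 : ℕ)}.encard
        ≤ {w | ω v w ≤ i}.encard + {w | (weightDigraph ω (i + 1)).Adj v w}.encard :=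
          hsplit ▸ Set.encard_union_le _ _
      _ ≤ outDegreeBound s c i + maxOutDegree (weightDigraph ω (i + 1)) :=
          add_le_add (ih (by omega) v) (encard_setOf_adj_le_maxOutDegree _ v)
      _ ≤ outDegreeBound s c i + degeneracy (weightDigraph ω (i + 1)).toSimpleGraphInclusive := by
          gcongr
          exact hdeg _ (by omega) hit
      _ ≤ outDegreeBound s c (i + 1) := by
          rw [outDegreeBound, Nat.cast_add (outDegreeBound s c i)]
          gcongr
          exact degeneracy_weightDigraph_le hgrad hω hF hit (by omega) hlighter

end OutDegree

theorem mainTheorem5_general (t : ℕ) (ht : 1 ≤ t) (C : ℝ≥0) :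
    ∃ Δ : ℕ, ∀ (V : Type*) [Finite V] (F : SimpleGraph V),
      grad (t - 1) F ≤ (C : ℝ≥0∞) →
      ∀ M : WeightedDigraph V, IsFraternalExtension t F M →
        (∀ i, 1 ≤ i → i ≤ t →
          maxOutDegree (M.layer i) ≤ degeneracy (M.layer i).toSimpleGraphInclusive) →
        maxOutDegree M.toDigraph ≤ (Δ : ℕ∞) := by
  refine ⟨outDegreeBound (t - 1) ⌈C⌉₊ t, fun V _ F hF M hM hdeg => iSup_le fun v => ?_⟩
  obtain ⟨D, hD, ⟨ω, hω, hadj, hweight⟩, rfl⟩ := hM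
  have hlayer {i : ℕ} (hi : i ≤ t) := layer_eq_weightDigraph hadj hweight hi
  have hgrad : grad (t - 1) F ≤ ⌈C⌉₊ := hF.trans (by exact_mod_cast Nat.le_ceil C)
  have hF : ∀ x y, ω x y = 1 → F.Adj x y := fun x y hxy =>
    (hD.1 x y).2 (Or.inl (by rw [hlayer ht]; exact hxy))
  simp only [hadj]
  exact encard_setOf_weight_le_outDegreeBound hgrad (by omega) hω hF
    (fun i hi hit => hlayer hit ▸ hdeg i hi hit) le_rfl v

theorem mainTheorem5 (t : ℕ) (ht : 1 ≤ t) (C : ℝ≥0) :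
    ∃ Δ : ℕ, ∀ (V : Type*) [Finite V] (F : SimpleGraph V),
      grad (t - 1) F ≤ (C : ℝ≥0∞) →
      ∀ M : WeightedDigraph V, IsOptimalAcyclicFraternalExtension t F M →
        maxOutDegree M.toDigraph ≤ (Δ : ℕ∞) :=
  (mainTheorem5_general t ht C).imp fun _ hΔ V _ F hF M hM =>
    hΔ V F hF M hM.1 fun i hi hit => (hM.2 i hi hit).2.2.le
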